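/- **Setting.** Let $(\mathcal A,\mathcal H,D)$ be a spectral triple of compact type: $\mathcal A$ is a unital $*$-subalgebra of $\mathcal B(\mathcal H)$, $D$ is self-adjoint with compact resolvent, and each $a\in\mathcal A$ preserves the domain of $D$ and has bounded commutator $[D,a]$. Put $da=\sqrt{-1}\,[D,a]$. Let $\mathcal E=\operatorname{span}\{a[D,b]:a,b\in\mathcal A\}\subset\mathcal B(\mathcal H)$ be the bimodule of one-forms, $m_0:\mathcal E\otimes_{\mathcal A}\mathcal E\to\mathcal B(\mathcal H)$ the multiplication, $\mathcal J\subset\operatorname{Im}m_0$ the right submodule spanned by the elements $\sum_i[D,a_i][D,b_i]$ with $\sum_i a_i[D,b_i]=0$, $\Omega^2=\operatorname{Im}(m_0)/\mathcal J$, and $m:\mathcal E\otimes_{\mathcal A}\mathcal E\to\Omega^2$ the map induced by $m_0$. The differential $d:\mathcal E\to\Omega^2$ is $d\big(\sum_i (da_i)\,b_i\big)=m\big(\sum_i da_i\otimes db_i\big)$ (so $d(\omega a)=d(\omega)a+m(\omega\otimes da)$). Write $\mathcal Z(\mathcal A)$ for the center of $\mathcal A$ and $\mathcal Z(\mathcal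 E)=\{\omega\in\mathcal E:\ a\omega=\omega a\ \forall a\in\mathcal A\}$. **Assumptions.** (I) $\mathcal E$ is finitely generated projective as a left and as a right $\mathcal A$-module, and $\mathcal E\otimes_{\mathcal A}\mathcal E=\operatorname{Ker}(m)\oplus\mathcal F$ as right modules, with $\mathcal F\cong\operatorname{Im}(m)$; let $P_{\rm sym}$ be the projection onto $\operatorname{Ker}(m)$ along $\mathcal F$ and $\sigma=2P_{\rm sym}-1$. (II) $\sigma(\omega\otimes\eta)=\eta\otimes\omega$ for $\omega,\eta\in\mathcal Z(\mathcal E)$. (III) $\mathcal Z(\mathcal E)$ is finitely generated projective over $\mathcal Z(\mathcal A)$ and $\mathcal Z(\mathcal E)\otimes_{\mathcal Z(\mathcal A)}\mathcal A\to\mathcal E$, $\omega\otimes a\mapsto\omega a$, is bijective. (IV) $\mathcal E$ admits a pseudo-Riemannian bi-metric. Here a *pseudo-Riemannian metric* is a right $\mathcal A$-linear map $g:\mathcal E\otimes_{\mathcal A}\mathcal E\to\mathcal A$ with $g\sigma=g$ for which $V_g:\mathcal E\to\operatorname{Hom}_{\mathcal A}(\mathcal E,\mathcal A)$, $V_g(\omega)(\eta)=g(\omega\otimes\eta)$,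 is bijective; it is a *bi-metric* if it is also left $\mathcal A$-linear. A *connection* is a $\mathbb C$-linear map $\nabla:\mathcal E\to\mathcal E\otimes_{\mathcal A}\mathcal E$ with $\nabla(\omega a)=\nabla(\omega)a+\omega\otimes da$; it is *torsionless* if $m\circ\nabla=d$. For $\omega,\eta\in\mathcal Z(\mathcal E)$ put $$\Pi^0_g(\nabla)(\omega,\eta)=(g\otimes\mathrm{id})\,\sigma_{23}\,(\nabla\omega\otimes\eta+\nabla\eta\otimes\omega),\qquad S^0_g(\nabla)(\omega,\eta)=d\,g(\omega\otimes\eta)-\Pi^0_g(\nabla)(\omega,\eta),$$ where $\sigma_{23}=\mathrm{id}\otimes\sigma$. Let $S_g(\nabla):\mathcal E\otimes_{\mathcal A}\mathcal E\to\mathcal E$ be the additive map with $S_g(\nabla)(\omega a\otimes\eta b)=S^0_g(\nabla)(\omega,\eta)\,ab$ for $\omega,\eta\in\mathcal Z(\mathcal E)$, $a,b\in\mathcal A$ (it exists and is unique under (I)–(III)), and put $\Pi_g(\nabla)=dg-S_g(\nabla)$. Then $\nabla$ is *compatible* with $g$ if $\Pi_g(\nabla)(\omega\otimes\eta)=d\,g(\omega\otimes\eta)$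 for all $\omega,\eta\in\mathcal E$, and *Levi-Civita* for $g$ if it is torsionless and compatible with $g$. **Proposition.** Assume (I)–(IV), and let $\mathcal E$ be a free right $\mathcal A$-module with a basis $e_1,\dots,e_n\in\mathcal Z(\mathcal E)$ such that $d(e_i)=0$ for all $i$. Let $g_0$ be a pseudo-Riemannian bi-metric with $g_0(e_i\otimes e_j)=\delta_{ij}1$ whose Levi-Civita connection $\nabla_0$ satisfies $\nabla_0(e_i)=0$ for all $i$. Let $k\in\mathcal A$ be invertible and $g=k\,g_0$, which is again a pseudo-Riemannian metric. Define $\partial_j:\mathcal A\to\mathcal A$ by $da=\sum_j e_j\,\partial_j(a)$. Then $g$ has a unique Levi-Civita connection $\nabla$, and its Christoffel symbols, i.e. the unique elements $\Gamma^i_{jl}\in\mathcal A$ with $\nabla(e_i)=\sum_{j,l}e_j\otimes e_l\,\Gamma^i_{jl}$, are $$\Gamma^i_{jl}=\tfrac12\left(\delta_{il}\,k^{-1}\partial_j(k)+\delta_{ij}\,k^{-1}\partial_l(k)-\delta_{jl}\,k^{-1}\partial_i(k)\right).$$ -/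

import Mathlib

set_option linter.unusedVariables false

open scoped TensorProduct

/-! ### Tensor products over a noncommutative ring

Right modules over a ring `A` are modules over `Aᵐᵒᵖ`: `m · a` is `MulOpposite.op a • m`. -/

/-- The tensor product `M ⊗_A N` of a right `A`-module `M` and a left `A`-module `N`:
the quotient of `M ⊗_ℤ N` by the relations `m a ⊗ n = m ⊗ a n`. -/
def NCTensor (A M N : Type*) [Ring A] [AddCommGroup M] [AddCommGroup N]
    [Module Aᵐᵒᵖ M] [Module A N] : Type _ :=
  (M ⊗[ℤ] N) ⧸ Submodule.span ℤ
    {x : M ⊗[ℤ] N | ∃ (m : M) (a : A) (n : N), x = (MulOpposite.op a • m) ⊗ₜ n - m ⊗ₜ (a • n)}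

namespace NCTensor

section Basic

variable {A M N P : Type*} [Ring A] [AddCommGroup M] [AddCommGroup N] [AddCommGroup P]
  [Module Aᵐᵒᵖ M] [Module A N]

instance : AddCommGroup (NCTensor A M N) := inferInstanceAs (AddCommGroup (_ ⧸ _))

variable (A) in
/-- The elementary tensor `m ⊗_A n`. -/
def tmul (m : M) (n : N) : NCTensor A M N := Submodule.Quotient.mk (m ⊗ₜ[ℤ] n)

theorem tmul_add (m : M) (n n' : N) : tmul A m (n + n') = tmul A m n + tmul A m n' := by
  unfold tmul; rw [TensorProduct.tmul_add]; rfl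

theorem add_tmul (m m' : M) (n : N) : tmul A (m + m') n = tmul A m n + tmul A m' n := by
  unfold tmul; rw [TensorProduct.add_tmul]; rfl

theorem smul_tmul (m : M) (a : A) (n : N) :
    tmul A (MulOpposite.op a • m) n = tmul A m (a • n) := by
  unfold tmul
  exact (Submodule.Quotient.eq _).2 (Submodule.subset_span ⟨m, a, n, rfl⟩)

/-- The additive map out of `M ⊗_A N` induced by an `A`-balanced biadditive map. -/
def lift (f : M →+ N →+ P) (hf : ∀ m (a : A) n, f (MulOpposite.op a • m) n = f m (a • n)) :
    NCTensor A M N →+ P :=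
  (Submodule.liftQ _ (TensorProduct.liftAddHom f (fun r m n => by simp)).toIntLinearMap (by
    rw [Submodule.span_le]
    rintro x ⟨m, a, n, rfl⟩
    simp [hf])).toAddMonoidHom

@[simp] theorem lift_tmul (f : M →+ N →+ P)
    (hf : ∀ m (a : A) n, f (MulOpposite.op a • m) n = f m (a • n)) (m : M) (n : N) :
    lift f hf (tmul A m n) = f m n := rfl

theorem induction_on {p : NCTensor A M N → Prop} (x : NCTensor A M N) (zero : p 0)
    (tmul : ∀ m n, p (tmul A m n)) (add : ∀ x y, p x → p y → p (x + y)) : p x := by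
  obtain ⟨y, rfl⟩ := Submodule.Quotient.mk_surjective _ x
  induction y using TensorProduct.induction_on with
  | zero => exact zero
  | tmul m n => exact tmul m n
  | add a b ha hb => exact add _ _ ha hb

variable (A) in
/-- The biadditive map `(m, n) ↦ m ⊗_A n`. -/
def tmulHom : M →+ N →+ NCTensor A M N where
  toFun m :=
    { toFun := tmul A m
      map_zero' := by unfold tmul; rw [TensorProduct.tmul_zero]; rfl
      map_add' := tmul_add m }
  map_zero' := by ext n; show tmul A 0 n = 0; unfold tmul; rw [TensorProduct.zero_tmul]; rfl
  map_add' m m' := by ext n; exact add_tmul m m' n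

theorem hom_ext {f g : NCTensor A M N →+ P} (h : ∀ m n, f (tmul A m n) = g (tmul A m n)) :
    f = g := by
  ext x
  induction x using induction_on with
  | zero => simp
  | tmul m n => exact h m n
  | add x y hx hy => rw [map_add, map_add, hx, hy]

/-- The module structure given by a family of additive maps indexed by a ring. -/
@[reducible] def moduleOfEnd {R X : Type*} [Ring R] [AddCommGroup X] (f : R → X →+ X)
    (h1 : f 1 = AddMonoidHom.id X) (hm : ∀ r s, f (r * s) = (f r).comp (f s))
    (ha : ∀ r s, f (r + s) = f r + f s) : Module R X where
  smul r x := f r x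
  one_smul x := DFunLike.congr_fun h1 x
  mul_smul r s x := DFunLike.congr_fun (hm r s) x
  smul_zero r := map_zero (f r)
  smul_add r := map_add (f r)
  add_smul r s x := DFunLike.congr_fun (ha r s) x
  zero_smul x := by
    have h : f 0 = 0 := by simpa using ha 0 0
    exact DFunLike.congr_fun h x

theorem tmul_zero (m : M) : tmul A m (0 : N) = 0 := map_zero (tmulHom A m)

theorem zero_tmul (n : N) : tmul A (0 : M) n = 0 := DFunLike.congr_fun (map_zero (tmulHom A)) n

/-- A second action on `M` that commutes with the right action of `A` acts on `M ⊗_A N` by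
`r (m ⊗ n) = (r m) ⊗ n`. -/
@[reducible] def leftModule (R : Type*) [Ring R] [Module R M] [SMulCommClass R Aᵐᵒᵖ M] :
    Module R (NCTensor A M N) :=
  moduleOfEnd
    (fun r => lift ((tmulHom A).comp (DistribSMul.toAddMonoidHom M r))
      (fun m a n => by
        show tmul A (r • MulOpposite.op a • m) n = tmul A (r • m) (a • n)
        rw [smul_comm, smul_tmul]))
    (hom_ext fun m n => by show tmul A ((1 : R) • m) n = tmul A m n; rw [one_smul])
    (fun r s => hom_ext fun m n => by
      show tmul A ((r * s) • m) n = tmul A (r • s • m) n; rw [mul_smul])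
    (fun r s => hom_ext fun m n => by
      show tmul A ((r + s) • m) n = tmul A (r • m) n + tmul A (s • m) n
      rw [add_smul, add_tmul])

/-- The right action `(m ⊗ n) a = m ⊗ (n a)`. -/
instance rightModule [Module Aᵐᵒᵖ N] [SMulCommClass A Aᵐᵒᵖ N] :
    Module Aᵐᵒᵖ (NCTensor A M N) :=
  moduleOfEnd
    (fun r => lift
      { toFun := fun m => ((tmulHom A) m).comp (DistribSMul.toAddMonoidHom N r)
        map_zero' := by ext n; simp
        map_add' := fun m m' => by ext n; simp }
      (fun m a n => by
        show tmul A (MulOpposite.op a • m) (r • n) = tmul A m (r • a • n)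
        rw [smul_tmul, smul_comm]))
    (hom_ext fun m n => by show tmul A m ((1 : Aᵐᵒᵖ) • n) = tmul A m n; rw [one_smul])
    (fun r s => hom_ext fun m n => by
      show tmul A m ((r * s) • n) = tmul A m (r • s • n); rw [mul_smul])
    (fun r s => hom_ext fun m n => by
      show tmul A m ((r + s) • n) = tmul A m (r • n) + tmul A m (s • n)
      rw [add_smul, tmul_add])

@[simp] theorem op_smul_tmul [Module Aᵐᵒᵖ N] [SMulCommClass A Aᵐᵒᵖ N] (r : Aᵐᵒᵖ) (m : M) (n : N) :
    r • tmul A m n = tmul A m (r • n) := rfl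

/-- The left action of `A` when `M` is an `A`-bimodule. -/
instance leftModuleSelf [Module A M] [SMulCommClass A Aᵐᵒᵖ M] : Module A (NCTensor A M N) :=
  leftModule A

/-- The scalar action when `M` is a complex vector space. -/
instance complexModule [Module ℂ M] [SMulCommClass ℂ Aᵐᵒᵖ M] : Module ℂ (NCTensor A M N) :=
  leftModule ℂ

@[simp] theorem left_smul_tmul [Module A M] [SMulCommClass A Aᵐᵒᵖ M] (r : A) (m : M) (n : N) :
    r • tmul A m n = tmul A (r • m) n := rfl

instance [Module A M] [SMulCommClass A Aᵐᵒᵖ M] [Module Aᵐᵒᵖ N] [SMulCommClass A Aᵐᵒᵖ N] :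
    SMulCommClass A Aᵐᵒᵖ (NCTensor A M N) where
  smul_comm a b x := by
    induction x using induction_on with
    | zero => simp only [smul_zero]
    | tmul m n => rfl
    | add x y hx hy => simp only [smul_add, hx, hy]

/-- The map `id ⊗_A f : M ⊗_A N → M ⊗_A P` of a left `A`-linear map `f`. -/
def lTensor {P : Type*} [AddCommGroup P] [Module A P] (f : N →ₗ[A] P) :
    NCTensor A M N →+ NCTensor A M P :=
  lift
    { toFun := fun m => ((tmulHom A) m).comp f.toAddMonoidHom
      map_zero' := by ext n; simp
      map_add' := fun m m' => by ext n; simp }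
    (fun m a n => by
      show tmul A (MulOpposite.op a • m) (f n) = tmul A m (f (a • n))
      rw [smul_tmul, map_smul])

@[simp] theorem lTensor_tmul {P : Type*} [AddCommGroup P] [Module A P] (f : N →ₗ[A] P)
    (m : M) (n : N) : lTensor f (tmul A m n) = tmul A m (f n) := rfl

end Basic

end NCTensor

/-! ### Metrics, connections and the Levi-Civita property for a bimodule of one-forms -/

/-- The maps `d : A → E`, `m : E ⊗_A E → Ω` and `d₁ : E → Ω` attached to a bimodule `E` of
one-forms and a right module `Ω` of two-forms over an algebra `A`. They are constructed below for
a spectral triple. -/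
structure DiffCalculus (A E Ω : Type*) [Ring A] [Algebra ℂ A] [AddCommGroup E] [Module ℂ E]
    [Module A E] [Module Aᵐᵒᵖ E] [SMulCommClass A Aᵐᵒᵖ E] [SMulCommClass ℂ Aᵐᵒᵖ E]
    [AddCommGroup Ω] [Module Aᵐᵒᵖ Ω] where
  d : A →ₗ[ℂ] E
  d_mul : ∀ a b, d (a * b) = MulOpposite.op b • d a + a • d b
  m : NCTensor A E E →ₗ[Aᵐᵒᵖ] Ω
  d₁ : E → Ω

namespace DiffCalculus

open MulOpposite NCTensor

section Center

variable (A E : Type*) [Ring A] [Algebra ℂ A] [AddCommGroup E]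
    [Module A E] [Module Aᵐᵒᵖ E] [SMulCommClass A Aᵐᵒᵖ E]

/-- The center `𝒵(A)`. -/
abbrev ZA : Type _ := Subalgebra.center ℂ A

/-- The center `𝒵(E)` of a bimodule, as a `𝒵(A)`-module. -/
def centralSubmodule : Submodule (ZA A) E where
  carrier := {e | ∀ a : A, a • e = op a • e}
  zero_mem' a := by simp
  add_mem' {e f} he hf a := by rw [smul_add, smul_add, he a, hf a]
  smul_mem' z e he a := by
    show a • (z : A) • e = op a • (z : A) • e
    rw [← mul_smul, Subalgebra.mem_center_iff.1 z.2 a, mul_smul, he a, smul_comm]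

/-- The center `𝒵(E)`. -/
abbrev ZE : Type _ := centralSubmodule A E

variable {A E}

theorem central_smul (e : ZE A E) (a : A) : a • (e : E) = op a • (e : E) := e.2 a

variable (A E)

/-- The map `u : 𝒵(E) ⊗_{𝒵(A)} A → E`, `e ⊗ a ↦ e a`. -/
noncomputable def u : ZE A E ⊗[ZA A] A →ₗ[ZA A] E :=
  TensorProduct.lift (LinearMap.mk₂ (ZA A) (fun (e : ZE A E) (a : A) => op a • (e : E))
    (fun e f a => by simp)
    (fun z e a => by
      show op a • (z : A) • (e : E) = (z : A) • op a • (e : E)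
      rw [← smul_comm (z : A)])
    (fun e a b => by rw [op_add, add_smul])
    (fun z e a => by
      show op ((z : A) * a) • (e : E) = (z : A) • op a • (e : E)
      rw [op_mul, mul_smul, ← central_smul, ← smul_comm (z : A)]))

@[simp] theorem u_tmul (e : ZE A E) (a : A) : u A E (e ⊗ₜ a) = op a • (e : E) := rfl

end Center

variable {A E Ω : Type*} [Ring A] [Algebra ℂ A] [AddCommGroup E] [Module ℂ E]
    [Module A E] [Module Aᵐᵒᵖ E] [SMulCommClass A Aᵐᵒᵖ E] [SMulCommClass ℂ Aᵐᵒᵖ E]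
    [AddCommGroup Ω] [Module Aᵐᵒᵖ Ω] (C : DiffCalculus A E Ω)

/-- A splitting `E ⊗_A E = Ker m ⊕ F` into right submodules with `F ≅ Im m`. -/
structure Splitting where
  F : Submodule Aᵐᵒᵖ (NCTensor A E E)
  isCompl : IsCompl (LinearMap.ker C.m) F
  equiv_range : Nonempty (F ≃ₗ[Aᵐᵒᵖ] LinearMap.range C.m)

variable {C} (s : C.Splitting)

namespace Splitting

/-- The projection onto `Ker m` along `F`. -/
noncomputable def Psym : NCTensor A E E →ₗ[Aᵐᵒᵖ] NCTensor A E E :=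
  (LinearMap.ker C.m).projection s.F s.isCompl

/-- `σ = 2 P_sym - 1`. -/
noncomputable def σ : NCTensor A E E →ₗ[Aᵐᵒᵖ] NCTensor A E E :=
  (2 : ℕ) • s.Psym - LinearMap.id

end Splitting

/-- A pseudo-Riemannian metric: a right `A`-linear map `g : E ⊗_A E → A` with `g σ = g`, such that
`V_g : E → E^*`, `V_g(ω)(η) = g(ω ⊗ η)` (which is always right `A`-linear) is bijective. -/
structure Metric where
  toLin : NCTensor A E E →ₗ[Aᵐᵒᵖ] A
  symm : toLin ∘ₗ s.σ = toLin
  nondegenerate : Function.Bijective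
    (fun ω : E => ({ toFun := fun η => toLin (tmul A ω η)
                     map_add' := fun _ _ => by rw [tmul_add, map_add]
                     map_smul' := fun a η => by
                      rw [← op_smul_tmul, map_smul, RingHom.id_apply] } : E →ₗ[Aᵐᵒᵖ] A))

namespace Metric

variable {s}

/-- A bi-metric is a metric that is an `A`-bimodule map. -/
def IsBimetric (g : Metric s) : Prop := ∀ (a : A) x, g.toLin (a • x) = a * g.toLin x

/-- The conformally deformed metric `k g`. -/
noncomputable def conformal (g : Metric s) (k : Aˣ) : Metric s where
  toLin := (k : A) • g.toLin
  symm := by rw [LinearMap.smul_comp, g.symm]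
  nondegenerate := by
    have hb : Function.Bijective (fun f : E →ₗ[Aᵐᵒᵖ] A => (k : A) • f) := by
      constructor
      · intro f f' h
        have := congrArg (fun f => ((k⁻¹ : Aˣ) : A) • f) h
        simpa [smul_smul] using this
      · intro f
        exact ⟨((k⁻¹ : Aˣ) : A) • f, by simp [smul_smul]⟩
    exact hb.comp g.nondegenerate

@[simp] theorem conformal_apply (g : Metric s) (k : Aˣ) (x : NCTensor A E E) :
    (g.conformal k).toLin x = k * g.toLin x := rfl

end Metric

/-- The standing assumptions on the bimodule `E` with the splitting `s`. -/
structure Assumptions : Prop where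
  left_finite : Module.Finite A E
  left_projective : Module.Projective A E
  right_finite : Module.Finite Aᵐᵒᵖ E
  right_projective : Module.Projective Aᵐᵒᵖ E
  /-- `σ` is the flip on central elements. -/
  flip : ∀ ω η : ZE A E, s.σ (tmul A (ω : E) (η : E)) = tmul A (η : E) (ω : E)
  center_finite : Module.Finite (ZA A) (ZE A E)
  center_projective : Module.Projective (ZA A) (ZE A E)
  u_bijective : Function.Bijective (u A E)
  exists_bimetric : ∃ g : Metric s, g.IsBimetric

variable (C) in
/-- A right connection on `E`. -/
structure Connection where
  toLin : E →ₗ[ℂ] NCTensor A E E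
  leibniz : ∀ (ω : E) (a : A), toLin (op a • ω) = op a • toLin ω + tmul A ω (C.d a)

/-- `∇` is torsionless if `m ∘ ∇ = d`. -/
def Connection.IsTorsionless (N : C.Connection) : Prop := ∀ ω, C.m (N.toLin ω) = C.d₁ ω

section Compatibility

variable {s}

theorem Assumptions.central_induction (h : Assumptions s) {p : E → Prop} (ω : E) (zero : p 0)
    (mul : ∀ (e : ZE A E) (a : A), p (op a • (e : E)))
    (add : ∀ x y, p x → p y → p (x + y)) : p ω := by
  obtain ⟨x, rfl⟩ := h.u_bijective.2 ω
  induction x using TensorProduct.induction_on with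
  | zero => rw [map_zero]; exact zero
  | tmul e a => exact mul e a
  | add x y hx hy => rw [map_add]; exact add _ _ hx hy

theorem Assumptions.center_smul (h : Assumptions s) (z : ZA A) (ω : E) :
    (z : A) • ω = op (z : A) • ω := by
  refine h.central_induction (p := fun ω => (z : A) • ω = op (z : A) • ω) ω (by simp)
    (fun e a => ?_) fun x y hx hy => ?_
  · rw [smul_comm, central_smul, ← mul_smul, ← mul_smul, ← op_mul, ← op_mul,
      Subalgebra.mem_center_iff.1 z.2 a]
  · rw [smul_add, smul_add, hx, hy]

theorem Assumptions.flip_right (h : Assumptions s) (ω : E) (η : ZE A E) :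
    s.σ (tmul A ω (η : E)) = tmul A (η : E) ω := by
  refine h.central_induction (p := fun ω => s.σ (tmul A ω (η : E)) = tmul A (η : E) ω) ω ?_
    (fun e a => ?_) fun x y hx hy => ?_
  · rw [zero_tmul, tmul_zero, map_zero]
  · rw [smul_tmul, central_smul, ← op_smul_tmul, map_smul, h.flip, op_smul_tmul]
  · rw [add_tmul, tmul_add, map_add, hx, hy]

theorem Assumptions.σ_smul (h : Assumptions s) (a : A) (x : NCTensor A E E) :
    s.σ (a • x) = a • s.σ x := by
  induction x using induction_on with
  | zero => rw [smul_zero, map_zero, smul_zero]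
  | tmul ω η =>
    refine h.central_induction
      (p := fun η => s.σ (a • tmul A ω η) = a • s.σ (tmul A ω η)) η ?_
      (fun e b => ?_) fun x y hx hy => ?_
    · rw [tmul_zero, smul_zero, map_zero, smul_zero]
    · rw [← op_smul_tmul, smul_comm a, map_smul s.σ, map_smul s.σ, left_smul_tmul, h.flip_right,
        h.flip_right, smul_comm a, left_smul_tmul, central_smul, smul_tmul]
    · rw [tmul_add, smul_add, map_add, map_add, smul_add, hx, hy]
  | add x y hx hy => rw [smul_add, map_add, map_add, smul_add, hx, hy]

/-- `σ₂₃ = id ⊗ σ` on `E ⊗_A E ⊗_A E`. -/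
noncomputable def Assumptions.σ₂₃ (h : Assumptions s) :
    NCTensor A E (NCTensor A E E) →+ NCTensor A E (NCTensor A E E) :=
  NCTensor.lTensor
    ({ toFun := s.σ, map_add' := map_add _, map_smul' := h.σ_smul } :
      NCTensor A E E →ₗ[A] NCTensor A E E)

variable (A) in
/-- The map `X ↦ X ⊗ η` from `E ⊗_A E` to `E ⊗_A E ⊗_A E`. -/
noncomputable def tensorRight (η : E) : NCTensor A E E →+ NCTensor A E (NCTensor A E E) :=
  NCTensor.lTensor
    ({ toFun := fun ω => tmul A ω η
       map_add' := fun _ _ => add_tmul _ _ _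
       map_smul' := fun _ _ => rfl } : E →ₗ[A] NCTensor A E E)

/-- For fixed `ω`, the map `η ⊗ θ ↦ g(ω ⊗ η) θ`. -/
noncomputable def Metric.tensorIdAux (g : Metric s) (ω : E) : NCTensor A E E →+ E :=
  lift (P := E)
    { toFun := fun η => DistribSMul.toAddMonoidHom E (g.toLin (tmul A ω η))
      map_zero' := by ext1 θ; simp [tmul_zero]
      map_add' := fun η η' => by ext1 θ; simp [tmul_add, add_smul] }
    (fun η a θ => by
      show g.toLin (tmul A ω (op a • η)) • θ = g.toLin (tmul A ω η) • a • θ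
      rw [← op_smul_tmul, map_smul, op_smul_eq_mul, mul_smul])

theorem Metric.tensorIdAux_tmul (g : Metric s) (ω η θ : E) :
    g.tensorIdAux ω (tmul A η θ) = g.toLin (tmul A ω η) • θ := rfl

/-- The map `g ⊗ id : E ⊗_A E ⊗_A E → E`, `ω ⊗ η ⊗ θ ↦ g(ω ⊗ η) θ`. -/
noncomputable def Metric.tensorId (g : Metric s) : NCTensor A E (NCTensor A E E) →+ E :=
  lift
    { toFun := g.tensorIdAux
      map_zero' := hom_ext fun η θ => by
        rw [g.tensorIdAux_tmul, zero_tmul, map_zero, zero_smul, AddMonoidHom.zero_apply]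
      map_add' := fun ω ω' => hom_ext fun η θ => by
        rw [AddMonoidHom.add_apply, g.tensorIdAux_tmul, g.tensorIdAux_tmul, g.tensorIdAux_tmul,
          add_tmul, map_add, add_smul] }
    (fun ω a x => by
      show g.tensorIdAux (op a • ω) x = g.tensorIdAux ω (a • x)
      induction x using induction_on with
      | zero => rw [smul_zero, map_zero, map_zero]
      | tmul η θ =>
        rw [left_smul_tmul, g.tensorIdAux_tmul, g.tensorIdAux_tmul, smul_tmul]
      | add x y hx hy => rw [smul_add, map_add, map_add, hx, hy])

/-- `Π⁰_g(∇)(ω, η) = (g ⊗ id) σ₂₃ (∇ω ⊗ η + ∇η ⊗ ω)`. -/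
noncomputable def Pi0 (h : Assumptions s) (g : Metric s) (N : C.Connection) (ω η : ZE A E) : E :=
  g.tensorId (h.σ₂₃ (tensorRight A (η : E) (N.toLin ω) + tensorRight A (ω : E) (N.toLin η)))

/-- `S⁰_g(∇)(ω, η) = d g(ω ⊗ η) - Π⁰_g(∇)(ω, η)`. -/
noncomputable def S0 (h : Assumptions s) (g : Metric s) (N : C.Connection) (ω η : ZE A E) : E :=
  C.d (g.toLin (tmul A (ω : E) (η : E))) - Pi0 h g N ω η

theorem contract_tmul (h : Assumptions s) (g : Metric s) (η : ZE A E) (ω₁ ω₂ : E) :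
    g.tensorId (h.σ₂₃ (tensorRight A (η : E) (tmul A ω₁ ω₂))) =
      g.toLin (tmul A ω₁ (η : E)) • ω₂ := by
  show g.tensorId (tmul A ω₁ (s.σ (tmul A ω₂ (η : E)))) = _
  rw [h.flip_right]
  rfl

theorem contract_op_smul (h : Assumptions s) (g : Metric s) (η : ZE A E) (a : A)
    (x : NCTensor A E E) :
    g.tensorId (h.σ₂₃ (tensorRight A (η : E) (op a • x))) =
      op a • g.tensorId (h.σ₂₃ (tensorRight A (η : E) x)) := by
  induction x using induction_on with
  | zero => simp only [smul_zero, map_zero]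
  | tmul ω₁ ω₂ => rw [op_smul_tmul, contract_tmul, contract_tmul, smul_comm]
  | add x y hx hy => simp only [smul_add, map_add, hx, hy]

theorem contract_center (h : Assumptions s) (g : Metric s) (η : ZE A E) (z : ZA A)
    (x : NCTensor A E E) :
    g.tensorId (h.σ₂₃ (tensorRight A ((z • η : ZE A E) : E) x)) =
      op (z : A) • g.tensorId (h.σ₂₃ (tensorRight A (η : E) x)) := by
  induction x using induction_on with
  | zero => simp only [smul_zero, map_zero]
  | tmul ω₁ ω₂ =>
    rw [contract_tmul, contract_tmul]
    have : tmul A ω₁ ((z • η : ZE A E) : E) = op (z : A) • tmul A ω₁ (η : E) := by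
      rw [op_smul_tmul, ← central_smul]; rfl
    rw [this, map_smul, op_smul_eq_mul, mul_smul, h.center_smul, smul_comm]
  | add x y hx hy => simp only [smul_add, map_add, hx, hy]

theorem Metric.symm_central (h : Assumptions s) (g : Metric s) (ω η : ZE A E) :
    g.toLin (tmul A (ω : E) (η : E)) = g.toLin (tmul A (η : E) (ω : E)) := by
  rw [← h.flip η ω]
  exact DFunLike.congr_fun g.symm _

theorem S0_comm (h : Assumptions s) (g : Metric s) (N : C.Connection) (ω η : ZE A E) :
    S0 h g N ω η = S0 h g N η ω := by
  rw [S0, S0, Pi0, Pi0, g.symm_central h, add_comm]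

theorem S0_smul_right (h : Assumptions s) (g : Metric s) (N : C.Connection) (z : ZA A)
    (ω η : ZE A E) : S0 h g N ω (z • η) = op (z : A) • S0 h g N ω η := by
  have h1 : ((z • η : ZE A E) : E) = op (z : A) • (η : E) := by
    rw [← central_smul]; rfl
  have h2 : C.d (g.toLin (tmul A (ω : E) ((z • η : ZE A E) : E))) =
      op (z : A) • C.d (g.toLin (tmul A (ω : E) (η : E))) +
        g.toLin (tmul A (ω : E) (η : E)) • C.d z := by
    rw [h1, ← op_smul_tmul, map_smul, op_smul_eq_mul, C.d_mul]
  have h3 : N.toLin ((z • η : ZE A E) : E) = op (z : A) • N.toLin η + tmul A (η : E) (C.d z) := by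
    rw [h1, N.leibniz]
  rw [S0, S0, Pi0, Pi0, h2, h3]
  simp only [map_add, contract_center, contract_op_smul, contract_tmul, smul_sub, smul_add,
    g.symm_central h η ω]
  abel

theorem S0_add_right (h : Assumptions s) (g : Metric s) (N : C.Connection)
    (ω η η' : ZE A E) : S0 h g N ω (η + η') = S0 h g N ω η + S0 h g N ω η' := by
  have h1 : ∀ x, g.tensorId (h.σ₂₃ (tensorRight A ((η + η' : ZE A E) : E) x)) =
      g.tensorId (h.σ₂₃ (tensorRight A (η : E) x)) +
        g.tensorId (h.σ₂₃ (tensorRight A (η' : E) x)) := by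
    intro x
    induction x using induction_on with
    | zero => simp only [map_zero, add_zero]
    | tmul ω₁ ω₂ =>
      rw [contract_tmul, contract_tmul, contract_tmul, Submodule.coe_add, tmul_add, map_add,
        add_smul]
    | add x y hx hy => simp only [map_add, hx, hy]; abel
  have h2 : N.toLin ((η + η' : ZE A E) : E) = N.toLin η + N.toLin η' := by
    rw [Submodule.coe_add, map_add]
  simp only [S0, Pi0, h2, map_add, h1]
  rw [Submodule.coe_add, tmul_add, map_add, map_add]
  abel

/-- `S⁰_g(∇)` as a `𝒵(A)`-bilinear map. -/
noncomputable def S0Bilin (h : Assumptions s) (g : Metric s) (N : C.Connection) :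
    ZE A E →ₗ[ZA A] ZE A E →ₗ[ZA A] E :=
  LinearMap.mk₂ (ZA A) (S0 h g N)
    (fun ω ω' η => by rw [S0_comm, S0_add_right, S0_comm h g N η, S0_comm h g N η])
    (fun z ω η => by
      rw [S0_comm, S0_smul_right, ← h.center_smul, S0_comm]; rfl)
    (fun ω η η' => S0_add_right h g N ω η η')
    (fun z ω η => by rw [S0_smul_right, ← h.center_smul]; rfl)

/-- The inverse of `u : 𝒵(E) ⊗_{𝒵(A)} A → E`. -/
noncomputable def Assumptions.uInv (h : Assumptions s) : E →ₗ[ZA A] ZE A E ⊗[ZA A] A :=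
  (LinearEquiv.ofBijective (u A E) h.u_bijective).symm

theorem Assumptions.uInv_op_smul (h : Assumptions s) (e : ZE A E) (a : A) :
    h.uInv (op a • (e : E)) = e ⊗ₜ a :=
  (LinearEquiv.ofBijective (u A E) h.u_bijective).symm_apply_eq.2 (u_tmul A E e a).symm

/-- `a ↦ a η` as a `𝒵(A)`-linear map. -/
noncomputable def actOn (η : E) : A →ₗ[ZA A] E where
  toFun a := a • η
  map_add' a b := add_smul _ _ _
  map_smul' z a := mul_smul (z : A) a η

/-- The map `T^L = u⁻¹ ⊗ id : E ⊗_A E → 𝒵(E) ⊗_{𝒵(A)} A ⊗_A E = 𝒵(E) ⊗_{𝒵(A)} E`. -/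
noncomputable def Assumptions.TL (h : Assumptions s) :
    NCTensor A E E →+ ZE A E ⊗[ZA A] E :=
  lift
    { toFun := fun ω =>
        { toFun := fun η => (actOn η).lTensor (ZE A E) (h.uInv ω)
          map_zero' := by
            rw [show actOn (0 : E) = (0 : A →ₗ[ZA A] E) from LinearMap.ext fun a => smul_zero a]
            simp
          map_add' := fun η η' => by
            rw [show actOn (η + η') = (actOn η + actOn η' : A →ₗ[ZA A] E) from
              LinearMap.ext fun a => smul_add a η η', LinearMap.lTensor_add]
            rfl }
      map_zero' := by ext1 η; simp
      map_add' := fun ω ω' => by ext1 η; simp }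
    (fun ω a η => by
      show (actOn η).lTensor (ZE A E) (h.uInv (op a • ω)) =
        (actOn (a • η)).lTensor (ZE A E) (h.uInv ω)
      refine h.central_induction (p := fun ω => (actOn η).lTensor (ZE A E) (h.uInv (op a • ω)) =
        (actOn (a • η)).lTensor (ZE A E) (h.uInv ω)) ω (by simp) (fun e b => ?_)
        fun x y hx hy => ?_
      · rw [← mul_smul, ← op_mul, h.uInv_op_smul, h.uInv_op_smul]
        simp [actOn, mul_smul]
      · rw [smul_add, map_add, map_add, map_add, map_add, hx, hy])

/-- The map `E ⊗_{𝒵(A)} A → E`, `ω ⊗ a ↦ ω a`. -/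
noncomputable def Assumptions.uAll (h : Assumptions s) : E ⊗[ZA A] A →ₗ[ZA A] E :=
  TensorProduct.lift (LinearMap.mk₂ (ZA A) (fun (e : E) (a : A) => op a • e)
    (fun e f a => smul_add _ _ _)
    (fun z e a => (smul_comm (z : A) (op a) e).symm)
    (fun e a b => by rw [op_add, add_smul])
    (fun z e a => by
      show op ((z : A) * a) • e = (z : A) • op a • e
      rw [op_mul, mul_smul, ← h.center_smul, ← smul_comm (z : A)]))

/-- `S_g(∇) = u ∘ (S⁰_g(∇) ⊗ id) ∘ (id ⊗ u⁻¹) ∘ T^L : E ⊗_A E → E`. -/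
noncomputable def Sg (h : Assumptions s) (g : Metric s) (N : C.Connection) :
    NCTensor A E E →+ E :=
  (h.uAll ∘ₗ (TensorProduct.lift (S0Bilin h g N)).rTensor A ∘ₗ
    (TensorProduct.assoc (ZA A) (ZE A E) (ZE A E) A).symm.toLinearMap ∘ₗ
      h.uInv.lTensor (ZE A E)).toAddMonoidHom.comp h.TL

theorem Sg_tmul (h : Assumptions s) (g : Metric s) (N : C.Connection) (ω η : ZE A E) (a b : A) :
    Sg h g N (tmul A (op a • (ω : E)) (op b • (η : E))) = op (a * b) • S0 h g N ω η := by
  have h1 : h.TL (tmul A (op a • (ω : E)) (op b • (η : E))) =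
      ω ⊗ₜ (op (a * b) • (η : E)) := by
    show (actOn (op b • (η : E))).lTensor (ZE A E) (h.uInv (op a • (ω : E))) = _
    rw [h.uInv_op_smul, LinearMap.lTensor_tmul]
    show ω ⊗ₜ[ZA A] (a • op b • (η : E)) = _
    rw [smul_comm, central_smul, ← mul_smul, ← op_mul]
  rw [Sg, AddMonoidHom.comp_apply, h1]
  simp only [LinearMap.toAddMonoidHom_coe, LinearMap.comp_apply, LinearMap.lTensor_tmul,
    h.uInv_op_smul]
  rfl

/-- `Π_g(∇) = d g - S_g(∇)`. -/
noncomputable def Pig (h : Assumptions s) (g : Metric s) (N : C.Connection)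
    (x : NCTensor A E E) : E :=
  C.d (g.toLin x) - Sg h g N x

/-- `∇` is compatible with `g` if `Π_g(∇)(ω ⊗ η) = d (g(ω ⊗ η))` for all `ω, η`. -/
def IsCompatible (h : Assumptions s) (g : Metric s) (N : C.Connection) : Prop :=
  ∀ ω η : E, Pig h g N (tmul A ω η) = C.d (g.toLin (tmul A ω η))

/-- `∇` is a Levi-Civita connection for `g` if it is torsionless and compatible with `g`. -/
def IsLeviCivita (h : Assumptions s) (g : Metric s) (N : C.Connection) : Prop :=
  N.IsTorsionless ∧ IsCompatible h g N

end Compatibility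

section FreeModule

variable {n : ℕ}

/-- The maps `∂ⱼ` with `d a = ∑ eⱼ ∂ⱼ(a)`, for a basis `e` of the right module `E`. -/
noncomputable def partialD (C : DiffCalculus A E Ω) (e : Module.Basis (Fin n) Aᵐᵒᵖ E) (j : Fin n)
    (a : A) : A :=
  unop (e.repr (C.d a) j)

/-- `Γ i j l` are the Christoffel symbols of `∇` for the basis `e`:
`∇(eᵢ) = ∑ eⱼ ⊗ e_l Γ i j l`. -/
def IsChristoffel (e : Module.Basis (Fin n) Aᵐᵒᵖ E) (N : C.Connection)
    (Γ : Fin n → Fin n → Fin n → A) : Prop :=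
  ∀ i, N.toLin (e i) = ∑ j, ∑ l, tmul A (e j) (op (Γ i j l) • e l)

end FreeModule

end DiffCalculus

/-! ### Spectral triples and their differential forms -/

/-- `T` is the bounded extension of the commutator `[D, a]`; in particular `a` preserves the
domain of `D`. -/
def IsBoundedCommutator {H : Type*} [NormedAddCommGroup H] [InnerProductSpace ℂ H]
    (D : H →ₗ.[ℂ] H) (a T : H →L[ℂ] H) : Prop :=
  ∀ (x : H) (hx : x ∈ D.domain),
    ∃ hax : a x ∈ D.domain, T x = D ⟨a x, hax⟩ - a (D ⟨x, hx⟩)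

/-- A spectral triple of compact type: a unital `*`-algebra of bounded operators on a Hilbert
space and a self-adjoint (densely defined, possibly unbounded) operator `D` with compact resolvent
and bounded commutators with the algebra. -/
structure SpectralTriple (H : Type*) [NormedAddCommGroup H] [InnerProductSpace ℂ H]
    [CompleteSpace H] where
  alg : StarSubalgebra ℂ (H →L[ℂ] H)
  D : H →ₗ.[ℂ] H
  selfAdjoint : IsSelfAdjoint D
  /-- `(D - i)⁻¹` is a compact operator. -/
  compact_resolvent : ∃ R : H →L[ℂ] H, IsCompactOperator R ∧
    (∀ y : H, ∃ h : R y ∈ D.domain, D ⟨R y, h⟩ - Complex.I • R y = y) ∧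
    (∀ x : D.domain, R (D x - Complex.I • (x : H)) = x)
  bounded_commutator : ∀ a ∈ alg, ∃ T : H →L[ℂ] H, IsBoundedCommutator D a T

namespace SpectralTriple

open MulOpposite NCTensor

variable {H : Type*} [NormedAddCommGroup H] [InnerProductSpace ℂ H] [CompleteSpace H]
  (S : SpectralTriple H)

/-- The algebra `𝒜`. -/
abbrev A : Type _ := S.alg

noncomputable instance : Ring S.A := inferInstance
noncomputable instance : AddCommGroup S.A := inferInstance
noncomputable instance : Semiring S.A := inferInstance
noncomputable instance : Algebra ℂ S.A := inferInstance
noncomputable instance : Module ℂ S.A := inferInstance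

/-- The bounded operator `[D, a]`. -/
noncomputable def comm (a : S.A) : H →L[ℂ] H := (S.bounded_commutator a a.2).choose

theorem comm_spec (a : S.A) : IsBoundedCommutator S.D a (S.comm a) :=
  (S.bounded_commutator a a.2).choose_spec

variable {S} in
theorem comm_eq {a : S.A} {T : H →L[ℂ] H} (hT : IsBoundedCommutator S.D a T) : S.comm a = T := by
  apply ContinuousLinearMap.ext_on
    (s := (S.D.domain : Set H)) (by
      have := S.selfAdjoint.dense_domain
      rwa [Submodule.span_eq])
  intro x hx
  obtain ⟨h1, e1⟩ := S.comm_spec a x hx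
  obtain ⟨h2, e2⟩ := hT x hx
  rw [e1, e2]

theorem comm_mul (a b : S.A) : S.comm (a * b) = S.comm a * b + a * S.comm b := by
  apply comm_eq
  intro x hx
  obtain ⟨h1, e1⟩ := S.comm_spec b x hx
  obtain ⟨h2, e2⟩ := S.comm_spec a _ h1
  refine ⟨h2, ?_⟩
  simp [e1, e2]

theorem comm_add (a b : S.A) : S.comm (a + b) = S.comm a + S.comm b := by
  apply comm_eq
  intro x hx
  obtain ⟨h1, e1⟩ := S.comm_spec a x hx
  obtain ⟨h2, e2⟩ := S.comm_spec b x hx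
  refine ⟨S.D.domain.add_mem h1 h2, ?_⟩
  have h : S.D ⟨(a + b : S.A).1 x, S.D.domain.add_mem h1 h2⟩ = S.D ⟨a.1 x, h1⟩ + S.D ⟨b.1 x, h2⟩ :=
    S.D.map_add ⟨_, h1⟩ ⟨_, h2⟩
  have h' : (a + b : S.A).1 (S.D ⟨x, hx⟩) = a.1 (S.D ⟨x, hx⟩) + b.1 (S.D ⟨x, hx⟩) := rfl
  rw [add_apply, e1, e2, h, h']
  abel

theorem comm_smul (c : ℂ) (a : S.A) : S.comm (c • a) = c • S.comm a := by
  apply comm_eq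
  intro x hx
  obtain ⟨h1, e1⟩ := S.comm_spec a x hx
  refine ⟨S.D.domain.smul_mem c h1, ?_⟩
  have h : S.D ⟨(c • a : S.A).1 x, S.D.domain.smul_mem c h1⟩ = c • S.D ⟨a.1 x, h1⟩ :=
    S.D.map_smul c ⟨_, h1⟩
  have h' : (c • a : S.A).1 (S.D ⟨x, hx⟩) = c • a.1 (S.D ⟨x, hx⟩) := rfl
  rw [smul_apply, e1, h, h', smul_sub]

/-- `a ↦ [D, a]` as a linear map. -/
noncomputable def commHom : S.A →ₗ[ℂ] (H →L[ℂ] H) where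
  toFun := S.comm
  map_add' := S.comm_add
  map_smul' := S.comm_smul

/-- The linear span of the operators `a [D, b]`. -/
noncomputable def oneForms : Submodule ℂ (H →L[ℂ] H) :=
  Submodule.span ℂ {T | ∃ a b : S.A, T = a * S.comm b}

theorem left_mem (a : S.A) {T : H →L[ℂ] H} (hT : T ∈ S.oneForms) :
    (a : H →L[ℂ] H) * T ∈ S.oneForms := by
  induction hT using Submodule.span_induction with
  | mem x hx =>
    obtain ⟨b, c, rfl⟩ := hx
    exact Submodule.subset_span ⟨a * b, c, by simp [mul_assoc]⟩
  | zero => simp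
  | add x y _ _ hx hy => rw [mul_add]; exact add_mem hx hy
  | smul c x _ hx => rw [mul_smul_comm]; exact Submodule.smul_mem _ c hx

theorem right_mem (a : S.A) {T : H →L[ℂ] H} (hT : T ∈ S.oneForms) :
    T * (a : H →L[ℂ] H) ∈ S.oneForms := by
  induction hT using Submodule.span_induction with
  | mem x hx =>
    obtain ⟨b, c, rfl⟩ := hx
    have : (b : H →L[ℂ] H) * S.comm c * a = b * S.comm (c * a) - (b * c : S.A) * S.comm a := by
      rw [comm_mul]; simp [mul_add, mul_assoc]
    rw [this]
    exact sub_mem (Submodule.subset_span ⟨_, _, rfl⟩) (Submodule.subset_span ⟨_, _, rfl⟩)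
  | zero => simp
  | add x y _ _ hx hy => rw [add_mul]; exact add_mem hx hy
  | smul c x _ hx => rw [smul_mul_assoc]; exact Submodule.smul_mem _ c hx

/-- The bimodule `ℰ` of one-forms. -/
abbrev OneForm : Type _ := S.oneForms

noncomputable instance : AddCommGroup S.OneForm := inferInstance
noncomputable instance : Module ℂ S.OneForm := inferInstance

noncomputable instance : Module S.A S.OneForm where
  smul a ω := ⟨a * ω, S.left_mem a ω.2⟩
  one_smul ω := Subtype.ext (one_mul _)
  mul_smul a b ω := Subtype.ext (mul_assoc _ _ _)
  smul_zero a := Subtype.ext (mul_zero _)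
  smul_add a ω η := Subtype.ext (mul_add _ _ _)
  add_smul a b ω := Subtype.ext (add_mul _ _ _)
  zero_smul ω := Subtype.ext (zero_mul _)

noncomputable instance : Module S.Aᵐᵒᵖ S.OneForm where
  smul a ω := ⟨ω * (unop a : S.A), S.right_mem _ ω.2⟩
  one_smul ω := Subtype.ext (mul_one _)
  mul_smul a b ω := Subtype.ext (mul_assoc _ _ _).symm
  smul_zero a := Subtype.ext (zero_mul _)
  smul_add a ω η := Subtype.ext (add_mul _ _ _)
  add_smul a b ω := Subtype.ext (mul_add _ _ _)
  zero_smul ω := Subtype.ext (mul_zero _)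

noncomputable instance : SMul S.A S.OneForm := inferInstance
noncomputable instance : SMul S.Aᵐᵒᵖ S.OneForm := inferInstance

instance : SMulCommClass S.A S.Aᵐᵒᵖ S.OneForm where
  smul_comm _ _ _ := Subtype.ext (mul_assoc _ _ _).symm

instance : SMulCommClass ℂ S.Aᵐᵒᵖ S.OneForm where
  smul_comm _ _ _ := Subtype.ext (smul_mul_assoc _ _ _).symm

/-- Right multiplication of bounded operators by elements of the algebra. -/
noncomputable instance : Module S.Aᵐᵒᵖ (H →L[ℂ] H) where
  smul a T := T * (unop a : S.A)
  one_smul T := mul_one _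
  mul_smul a b T := (mul_assoc _ _ _).symm
  smul_zero a := zero_mul _
  smul_add a T T' := add_mul _ _ _
  add_smul a b T := mul_add _ _ _
  zero_smul T := mul_zero _

@[simp] theorem coe_smul (a : S.A) (ω : S.OneForm) :
    ((a • ω : S.OneForm) : H →L[ℂ] H) = a * ω := rfl

@[simp] theorem coe_op_smul (a : S.Aᵐᵒᵖ) (ω : S.OneForm) :
    ((a • ω : S.OneForm) : H →L[ℂ] H) = ω * (unop a : S.A) := rfl

/-- The derivation `d a = √-1 [D, a]`. -/
noncomputable def d : S.A →ₗ[ℂ] S.OneForm where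
  toFun a := ⟨Complex.I • S.comm a,
    Submodule.smul_mem _ _ (Submodule.subset_span ⟨1, a, (one_mul _).symm⟩)⟩
  map_add' a b := Subtype.ext (by simp [comm_add])
  map_smul' c a := Subtype.ext (by simp [comm_smul, smul_comm c])

@[simp] theorem coe_d (a : S.A) : (S.d a : H →L[ℂ] H) = Complex.I • S.comm a := rfl

theorem d_mul (a b : S.A) : S.d (a * b) = op b • S.d a + a • S.d b :=
  Subtype.ext (by simp [comm_mul])

/-- `ℰ ⊗_𝒜 ℰ`. -/
abbrev EE : Type _ := NCTensor S.A S.OneForm S.OneForm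

/-- The multiplication map `ω ⊗ η ↦ ω η` into the bounded operators, as an additive map. -/
noncomputable def m₀Hom : S.EE →+ (H →L[ℂ] H) :=
  lift (P := H →L[ℂ] H)
    { toFun := fun ω =>
        { toFun := fun η => (ω : H →L[ℂ] H) * η
          map_zero' := mul_zero _
          map_add' := fun _ _ => mul_add _ _ _ }
      map_zero' := by ext1 η; exact zero_mul _
      map_add' := fun _ _ => by ext1 η; exact add_mul _ _ _ }
    (fun _ _ _ => mul_assoc _ _ _)

/-- The multiplication map `m₀ : ω ⊗ η ↦ ω η` into the bounded operators. -/
noncomputable def m₀ : S.EE →ₗ[S.Aᵐᵒᵖ] (H →L[ℂ] H) where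
  toFun := S.m₀Hom
  map_add' := map_add _
  map_smul' a x := by
    induction x using induction_on with
    | zero => rw [smul_zero, map_zero, smul_zero]
    | tmul ω η => exact (mul_assoc _ _ _).symm
    | add x y hx hy => rw [smul_add, map_add, map_add, smul_add, hx, hy]

@[simp] theorem m₀_tmul (ω η : S.OneForm) :
    S.m₀ (tmul S.A ω η) = (ω : H →L[ℂ] H) * (η : H →L[ℂ] H) := rfl

/-- The junk forms: the right submodule of `Im m₀` spanned by the elements `∑ [D, aᵢ] [D, bᵢ]`
with `∑ aᵢ [D, bᵢ] = 0`. -/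
noncomputable def junk : Submodule S.Aᵐᵒᵖ (LinearMap.range S.m₀) :=
  Submodule.span _ {x | ∃ (n : ℕ) (a b : Fin n → S.A),
    ∑ i, (a i : H →L[ℂ] H) * S.comm (b i) = 0 ∧
      (x : H →L[ℂ] H) = ∑ i, S.comm (a i) * S.comm (b i)}

/-- The module of two-forms `Im m₀ / junk`. -/
abbrev TwoForm : Type _ := LinearMap.range S.m₀ ⧸ S.junk

/-- The map `m : ℰ ⊗_𝒜 ℰ → Ω²`. -/
noncomputable def m : S.EE →ₗ[S.Aᵐᵒᵖ] S.TwoForm :=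
  S.junk.mkQ ∘ₗ S.m₀.rangeRestrict

/-- `a ⊗ b ↦ (da) b`. -/
noncomputable def repHom : S.A ⊗[ℤ] S.A →+ S.OneForm :=
  TensorProduct.liftAddHom
    { toFun := fun a =>
        { toFun := fun b => op b • S.d a
          map_zero' := by simp
          map_add' := fun _ _ => by rw [op_add, add_smul] }
      map_zero' := by ext1; simp
      map_add' := fun _ _ => by ext1; simp }
    (fun r a b => by
      show op b • S.d (r • a) = op (r • b) • S.d a
      rw [map_zsmul, op_smul, smul_assoc, smul_comm])

/-- `a ⊗ b ↦ m (da ⊗ db)`. -/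
noncomputable def dRepHom : S.A ⊗[ℤ] S.A →+ S.TwoForm :=
  TensorProduct.liftAddHom
    { toFun := fun a =>
        { toFun := fun b => S.m (tmul S.A (S.d a) (S.d b))
          map_zero' := by
            rw [map_zero]; exact (congrArg _ (map_zero (tmulHom S.A (S.d a)))).trans (map_zero _)
          map_add' := fun _ _ => by rw [map_add, tmul_add, map_add] }
      map_zero' := by
        ext1 b
        show S.m (tmul S.A (S.d 0) (S.d b)) = 0
        rw [map_zero]
        exact (congrArg _ (DFunLike.congr_fun (map_zero (tmulHom S.A)) (S.d b))).trans (map_zero _)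
      map_add' := fun a a' => by
        ext1 b
        show S.m (tmul S.A (S.d (a + a')) (S.d b)) =
          S.m (tmul S.A (S.d a) (S.d b)) + S.m (tmul S.A (S.d a') (S.d b))
        rw [map_add, add_tmul, map_add] }
    (fun r a b => by
      show S.m (tmul S.A (S.d (r • a)) (S.d b)) = S.m (tmul S.A (S.d a) (S.d (r • b)))
      congr 1
      rw [map_zsmul, map_zsmul]
      exact (DFunLike.congr_fun (map_zsmul (tmulHom S.A) r (S.d a)) (S.d b)).trans
        (map_zsmul (tmulHom S.A (S.d a)) r (S.d b)).symm)

@[simp] theorem repHom_tmul (a b : S.A) : S.repHom (a ⊗ₜ b) = op b • S.d a := rfl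

@[simp] theorem dRepHom_tmul (a b : S.A) :
    S.dRepHom (a ⊗ₜ b) = S.m (tmul S.A (S.d a) (S.d b)) := rfl

theorem repHom_surjective : Function.Surjective S.repHom := by
  rintro ⟨T, hT⟩
  suffices h : ∀ T (hT : T ∈ S.oneForms), ∃ x, (S.repHom x : H →L[ℂ] H) = T by
    obtain ⟨x, hx⟩ := h T hT
    exact ⟨x, Subtype.ext hx⟩
  intro T hT
  induction hT using Submodule.span_induction with
  | mem x hx =>
    obtain ⟨a, b, rfl⟩ := hx
    refine ⟨(-Complex.I • (a * b)) ⊗ₜ 1 - (-Complex.I • a) ⊗ₜ b, ?_⟩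
    simp [comm_mul, smul_smul]
  | zero => exact ⟨0, by simp⟩
  | add x y _ _ hx hy =>
    obtain ⟨x, rfl⟩ := hx
    obtain ⟨y, rfl⟩ := hy
    exact ⟨x + y, by simp⟩
  | smul c x _ hx =>
    obtain ⟨x, rfl⟩ := hx
    clear * -
    induction x using TensorProduct.induction_on with
    | zero => exact ⟨0, by simp⟩
    | tmul a b => exact ⟨(c • a) ⊗ₜ b, by simp⟩
    | add x y hx hy =>
      obtain ⟨x', hx⟩ := hx
      obtain ⟨y', hy⟩ := hy
      exact ⟨x' + y', by simp [hx, hy]⟩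

theorem exists_fin_sum (x : S.A ⊗[ℤ] S.A) :
    ∃ (n : ℕ) (a b : Fin n → S.A), x = ∑ i, a i ⊗ₜ[ℤ] b i := by
  induction x using TensorProduct.induction_on with
  | zero => exact ⟨0, Fin.elim0, Fin.elim0, by simp⟩
  | tmul a b => exact ⟨1, fun _ => a, fun _ => b, by simp⟩
  | add x y hx hy =>
    obtain ⟨n, a, b, rfl⟩ := hx
    obtain ⟨n', a', b', rfl⟩ := hy
    exact ⟨n + n', Fin.append a a', Fin.append b b', by simp [Fin.sum_univ_add]⟩

theorem comm_one : S.comm 1 = 0 := by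
  have h := S.comm_mul 1 1
  simpa using h

theorem dRepHom_eq_zero {x : S.A ⊗[ℤ] S.A} (hx : S.repHom x = 0) : S.dRepHom x = 0 := by
  obtain ⟨n, a, b, rfl⟩ := S.exists_fin_sum x
  have h0 : ∑ i, S.comm (a i) * (b i : H →L[ℂ] H) = 0 := by
    have h := congrArg (Subtype.val) hx
    rw [map_sum] at h
    simp only [repHom_tmul, AddSubmonoidClass.coe_finsetSum, coe_op_smul, coe_d, unop_op,
      smul_mul_assoc, ← Finset.smul_sum, ZeroMemClass.coe_zero] at h
    exact (smul_eq_zero.1 h).resolve_left Complex.I_ne_zero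
  rw [map_sum]
  simp only [dRepHom_tmul, ← map_sum]
  rw [m, LinearMap.comp_apply, Submodule.mkQ_apply, Submodule.Quotient.mk_eq_zero]
  refine Submodule.subset_span ⟨n + 1, Fin.cons 1 (-a), Fin.cons (∑ i, a i * b i) b, ?_, ?_⟩
  · have h1 : S.comm (∑ i, a i * b i) = ∑ i, S.comm (a i * b i) := map_sum S.commHom _ _
    rw [Fin.sum_univ_succ]
    simp only [Fin.cons_zero, Fin.cons_succ, Pi.neg_apply, h1, comm_mul, Finset.sum_add_distrib, h0]
    simp
  · have h2 : ∀ c : S.A, S.comm (-c) = -S.comm c := map_neg S.commHom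
    rw [Fin.sum_univ_succ]
    simp only [Fin.cons_zero, Fin.cons_succ, Pi.neg_apply, comm_one, h2]
    show S.m₀ (∑ i, tmul S.A (S.d (a i)) (S.d (b i))) = _
    rw [map_sum]
    simp [smul_smul]

/-- The differential `d : ℰ → Ω²` on one-forms, `d (∑ (d aᵢ) bᵢ) = m (∑ d aᵢ ⊗ d bᵢ)`. -/
noncomputable def d₁ (ω : S.OneForm) : S.TwoForm :=
  S.dRepHom (Function.surjInv S.repHom_surjective ω)

theorem d₁_sum {n : ℕ} (a b : Fin n → S.A) :
    S.d₁ (∑ i, op (b i) • S.d (a i)) = S.m (∑ i, tmul S.A (S.d (a i)) (S.d (b i))) := by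
  have h := S.dRepHom_eq_zero
    (x := Function.surjInv S.repHom_surjective (∑ i, op (b i) • S.d (a i)) -
      ∑ i, a i ⊗ₜ[ℤ] b i)
    (by
      rw [map_sub, Function.surjInv_eq S.repHom_surjective, map_sum, sub_eq_zero]
      rfl)
  rw [map_sub, sub_eq_zero, map_sum] at h
  rw [d₁, h, map_sum]
  rfl

/-- The maps `d : 𝒜 → ℰ`, `m : ℰ ⊗_𝒜 ℰ → Ω²` and `d : ℰ → Ω²` of a spectral triple. -/
noncomputable def calculus : DiffCalculus S.A S.OneForm S.TwoForm where
  d := S.d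
  d_mul := S.d_mul
  m := S.m
  d₁ := S.d₁

end SpectralTriple

/-! In a basis of central closed one-forms the problem becomes linear algebra for $n^3$ unknowns.
Since $\mathcal E$ is right free on the $e_i$, the tensors $e_j\otimes e_l$ form a right basis of
$\mathcal E\otimes_{\mathcal A}\mathcal E$, and by the Leibniz rule a connection is the same thing
as an arbitrary family $\Gamma^i_{jl}$ (`Connection.ext_basis`, `Connection.ofBasis`).

Torsion: $m\circ\nabla$ and $d$ obey the same Leibniz rule and $d(e_i)=0$, so only $m(\nabla e_i)=0$
matters. As $\sigma=2P_{\rm sym}-1$, the kernel of $m$ is the fixed space of $\sigma$, and $\sigma$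
flips $e_p\otimes e_q$; hence torsionless means $\Gamma^i_{jl}=\Gamma^i_{lj}$
(`Assumptions.m_eq_zero_iff`).

Compatibility: it amounts to $S^0_g(\nabla)(e_i,e_j)=0$. Contracting $\nabla e_i$ with $e_j$ through
$k g_0$ gives $\sum_l e_l\,k\,\Gamma^i_{jl}$, while $d\,g(e_i\otimes e_j)=\delta_{ij}\,dk$. So the
condition is $\Gamma^i_{jl}+\Gamma^j_{il}=\delta_{ij}\,k^{-1}\partial_l(k)$
(`isCompatible_conformal_iff`).

The classical Koszul argument solves these two systems uniquely (`koszul_conformal_iff`). It only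
adds, subtracts and halves entries, so noncommutativity of $\mathcal A$ does no harm: its only trace
is that $k^{-1}$ stands to the left of the derivatives. -/

namespace DiffCalculus

open MulOpposite NCTensor

set_option linter.unusedSectionVars false

/-! ### Coordinates on $\mathcal E$ and on $\mathcal E\otimes_{\mathcal A}\mathcal E$. -/

section TensorCoordinates

variable {A E : Type*} [Ring A] [AddCommGroup E] [Module A E] [Module Aᵐᵒᵖ E]
  [SMulCommClass A Aᵐᵒᵖ E] {n : ℕ} (e : Module.Basis (Fin n) Aᵐᵒᵖ E)

/-- The coordinate `aⱼ` of `ω = ∑ eⱼ aⱼ`, as a right linear map. -/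
noncomputable def basisCoord (j : Fin n) : E →ₗ[Aᵐᵒᵖ] A where
  toFun ω := unop (e.repr ω j)
  map_add' ω η := by simp
  map_smul' a ω := by simp

theorem sum_basisCoord (ω : E) : ∑ j, op (basisCoord e j ω) • e j = ω :=
  e.sum_repr ω

theorem basisCoord_basis (i j : Fin n) : basisCoord e j (e i) = if i = j then 1 else 0 := by
  show unop (e.repr (e i) j) = _
  rw [e.repr_self, Finsupp.single_apply]
  split_ifs <;> rfl

theorem basisCoord_op_smul (j : Fin n) (a : A) (ω : E) :
    basisCoord e j (op a • ω) = basisCoord e j ω * a := by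
  rw [map_smul, op_smul_eq_mul]

theorem basis_ext {ω η : E} (h : ∀ j, basisCoord e j ω = basisCoord e j η) : ω = η := by
  rw [← sum_basisCoord e ω, ← sum_basisCoord e η]
  simp only [h]

/-- The coordinate `a_{jl}` of `x = ∑ eⱼ ⊗ e_l a_{jl}`, as a right linear map. -/
noncomputable def tensorCoord (j l : Fin n) : NCTensor A E E →ₗ[Aᵐᵒᵖ] A where
  -- With $\omega=\sum_j e_ja_j$, each $a_j$ crosses the tensor sign and acts on $\eta$ from the
  -- left before the $l$-th coordinate is read off. No centrality of the basis is needed.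
  toFun := NCTensor.lift
    { toFun := fun ω => (basisCoord e l).toAddMonoidHom.comp
        (DistribSMul.toAddMonoidHom E (basisCoord e j ω))
      map_zero' := by ext η; simp
      map_add' := fun ω ω' => by ext η; simp [add_smul] }
    (fun ω a η => by
      show basisCoord e l (basisCoord e j (op a • ω) • η) =
        basisCoord e l (basisCoord e j ω • a • η)
      rw [basisCoord_op_smul, mul_smul])
  map_add' := map_add _
  map_smul' a x := by
    induction x using induction_on with
    | zero => simp only [smul_zero, map_zero]
    | tmul ω η =>
      show basisCoord e l (basisCoord e j ω • a • η) = a • basisCoord e l (basisCoord e j ω • η)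
      rw [smul_comm, map_smul]
    | add x y hx hy => simp only [smul_add, map_add, hx, hy]

theorem tensorCoord_tmul (j l : Fin n) (ω η : E) :
    tensorCoord e j l (tmul A ω η) = basisCoord e l (basisCoord e j ω • η) := rfl

theorem tensorCoord_basis (i p j l : Fin n) :
    tensorCoord e j l (tmul A (e i) (e p)) = if i = j ∧ p = l then 1 else 0 := by
  rw [tensorCoord_tmul, basisCoord_basis]
  by_cases hi : i = j
  · simp [hi, basisCoord_basis]
  · simp [hi]

theorem tmul_sum {ι : Type*} (t : Finset ι) (ω : E) (f : ι → E) :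
    tmul A ω (∑ i ∈ t, f i) = ∑ i ∈ t, tmul A ω (f i) :=
  map_sum (tmulHom A ω) f t

theorem sum_tmul {ι : Type*} (t : Finset ι) (f : ι → E) (η : E) :
    tmul A (∑ i ∈ t, f i) η = ∑ i ∈ t, tmul A (f i) η := by
  have h := map_sum (tmulHom (N := E) A) f t
  have h' := DFunLike.congr_fun h η
  rwa [AddMonoidHom.finsetSum_apply] at h'

/-- Expanding $a_j\eta$ in the basis and moving $a_j$ back across the tensor sign recovers
$\omega\otimes\eta$. Together with `tensorCoord_sum` this shows that the $e_j\otimes e_l$ are a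
right basis. -/
theorem sum_tensorCoord (x : NCTensor A E E) :
    ∑ j, ∑ l, tmul A (e j) (op (tensorCoord e j l x) • e l) = x := by
  induction x using induction_on with
  | zero => simp [tmul_zero]
  | tmul ω η =>
    simp only [tensorCoord_tmul, ← tmul_sum, sum_basisCoord, ← smul_tmul]
    rw [← sum_tmul, sum_basisCoord]
  | add x y hx hy =>
    simp only [map_add, op_add, add_smul, tmul_add, Finset.sum_add_distrib, hx, hy]

theorem tensor_ext {x y : NCTensor A E E} (h : ∀ j l, tensorCoord e j l x = tensorCoord e j l y) :
    x = y := by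
  rw [← sum_tensorCoord e x, ← sum_tensorCoord e y]
  simp only [h]

theorem tensorCoord_sum (Γ : Fin n → Fin n → A) (j l : Fin n) :
    tensorCoord e j l (∑ p, ∑ q, tmul A (e p) (op (Γ p q) • e q)) = Γ j l := by
  simp only [map_sum, ← op_smul_tmul, map_smul, op_smul_eq_mul, tensorCoord_basis]
  rw [Finset.sum_eq_single j, Finset.sum_eq_single l]
  · simp
  · intro q _ hq; simp [hq]
  · simp
  · intro p _ hp; simp [hp]
  · simp

end TensorCoordinates

/-! ### Connections in terms of their values on a basis. -/

variable {A E Ω : Type*} [Ring A] [Algebra ℂ A] [AddCommGroup E] [Module ℂ E]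
  [Module A E] [Module Aᵐᵒᵖ E] [SMulCommClass A Aᵐᵒᵖ E] [SMulCommClass ℂ Aᵐᵒᵖ E]
  [AddCommGroup Ω] [Module Aᵐᵒᵖ Ω] {C : DiffCalculus A E Ω} {s : C.Splitting}
  {n : ℕ} {e : Module.Basis (Fin n) Aᵐᵒᵖ E}

theorem isChristoffel_iff (N : C.Connection) (Γ : Fin n → Fin n → Fin n → A) :
    IsChristoffel e N Γ ↔ ∀ i j l, Γ i j l = tensorCoord e j l (N.toLin (e i)) := by
  refine ⟨fun h i j l => ?_, fun h i => ?_⟩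
  · rw [h i, tensorCoord_sum]
  · simp only [h, sum_tensorCoord]

theorem Connection.ext_toLin {N N' : C.Connection} (h : N.toLin = N'.toLin) : N = N' := by
  cases N; cases N'; congr

/-- A connection is determined by its values on a basis. -/
theorem Connection.ext_basis {N N' : C.Connection} (h : ∀ i, N.toLin (e i) = N'.toLin (e i)) :
    N = N' := by
  refine Connection.ext_toLin (LinearMap.ext fun ω => ?_)
  rw [← sum_basisCoord e ω]
  simp only [map_sum, Connection.leibniz, h]

/-- The connection with prescribed values on a basis, when complex scalars act on `E` through the
right action of `A`. -/
noncomputable def Connection.ofBasis (C : DiffCalculus A E Ω) (e : Module.Basis (Fin n) Aᵐᵒᵖ E)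
    (hl : ∀ (c : ℂ) (ω : E), c • ω = algebraMap ℂ A c • ω)
    (hr : ∀ (c : ℂ) (ω : E), c • ω = op (algebraMap ℂ A c) • ω)
    (X : Fin n → NCTensor A E E) : C.Connection where
  toLin :=
    { toFun := fun ω => ∑ i, (op (basisCoord e i ω) • X i + tmul A (e i) (C.d (basisCoord e i ω)))
      map_add' := fun ω η => by
        simp only [map_add, op_add, add_smul, tmul_add, ← Finset.sum_add_distrib]
        exact Finset.sum_congr rfl fun i _ => by abel
      map_smul' := fun c ω => by
        -- Complex scalars act on the first tensor factor and the right action on the second, so the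
        -- scalar has to be carried across the tensor sign as an element of $\mathcal A$.
        have hc : ∀ x : NCTensor A E E, c • x = op (algebraMap ℂ A c) • x := fun x => by
          induction x using induction_on with
          | zero => simp only [smul_zero]
          | tmul ω η =>
            show tmul A (c • ω) η = tmul A ω (op (algebraMap ℂ A c) • η)
            rw [hr, smul_tmul, ← hl, hr]
          | add x y hx hy => simp only [smul_add, hx, hy]
        have h1 : ∀ i, basisCoord e i (c • ω) = c • basisCoord e i ω := fun i => by
          rw [hr, basisCoord_op_smul, ← Algebra.commutes, Algebra.smul_def]
        simp only [RingHom.id_apply, Finset.smul_sum, h1, map_smul]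
        refine Finset.sum_congr rfl fun i _ => ?_
        rw [smul_add, hc, hc, op_smul_tmul, ← hr, ← mul_smul, ← op_mul, Algebra.smul_def,
          Algebra.commutes] }
  leibniz ω a := by
    simp only [LinearMap.coe_mk, AddHom.coe_mk, basisCoord_op_smul, C.d_mul, op_mul, mul_smul,
      tmul_add, Finset.smul_sum, smul_add, Finset.sum_add_distrib, op_smul_tmul, ← smul_tmul]
    -- The terms $e_ia_i\otimes da$ produced by $d(a_ia)$ reassemble to $\omega\otimes da$.
    rw [← sum_tmul, sum_basisCoord, add_assoc]

theorem d_one : C.d 1 = 0 := by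
  have h := C.d_mul 1 1
  simpa using h

theorem Connection.ofBasis_basis (hl : ∀ (c : ℂ) (ω : E), c • ω = algebraMap ℂ A c • ω)
    (hr : ∀ (c : ℂ) (ω : E), c • ω = op (algebraMap ℂ A c) • ω)
    (X : Fin n → NCTensor A E E) (i : Fin n) :
    (Connection.ofBasis C e hl hr X).toLin (e i) = X i := by
  show ∑ j, (op (basisCoord e j (e i)) • X j + tmul A (e j) (C.d (basisCoord e j (e i)))) = X i
  rw [Finset.sum_eq_single i]
  · simp [basisCoord_basis, d_one, tmul_zero]
  · intro j _ hj
    simp [basisCoord_basis, hj.symm, tmul_zero]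
  · simp

/-! ### Torsion as symmetry of the Christoffel symbols. -/

section Torsion

/-- If `d : E → Ω` satisfies the Leibniz rule and vanishes on a basis, torsion is checked on that
basis. -/
theorem isTorsionless_iff_basis (hadd : ∀ ω η, C.d₁ (ω + η) = C.d₁ ω + C.d₁ η)
    (hmul : ∀ ω (a : A), C.d₁ (op a • ω) = op a • C.d₁ ω + C.m (tmul A ω (C.d a)))
    (hd : ∀ i, C.d₁ (e i) = 0) (N : C.Connection) :
    N.IsTorsionless ↔ ∀ i, C.m (N.toLin (e i)) = 0 := by
  refine ⟨fun h i => (h _).trans (hd i), fun h ω => ?_⟩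
  have hsum : ∀ f : Fin n → E, C.d₁ (∑ i, f i) = ∑ i, C.d₁ (f i) := fun f =>
    map_sum (AddMonoidHom.mk' C.d₁ hadd) f _
  rw [← sum_basisCoord e ω, hsum, map_sum, map_sum]
  refine Finset.sum_congr rfl fun i _ => ?_
  -- The inhomogeneous terms $m(e_i\otimes da_i)$ agree on the two sides, so only the values on the
  -- basis are compared.
  rw [N.leibniz, hmul, map_add, map_smul, h, hd]

/-- $2P_{\rm sym}x-x=x$ is equivalent to $P_{\rm sym}x=x$ after dividing by 2 in a complex vector
space, and $P_{\rm sym}$ projects onto $\operatorname{Ker}(m)$. -/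
theorem Splitting.σ_eq_self_iff (x : NCTensor A E E) : s.σ x = x ↔ C.m x = 0 := by
  have h2 : s.σ x = (2 : ℕ) • s.Psym x - x := rfl
  rw [h2, sub_eq_iff_eq_add, ← two_nsmul, ← Nat.cast_smul_eq_nsmul ℂ, ← Nat.cast_smul_eq_nsmul ℂ,
    smul_right_inj (by norm_num), Splitting.Psym, Submodule.projection_eq_self_iff,
    LinearMap.mem_ker]

/-- By right linearity $\sigma$ is determined on the $e_p\otimes e_q$, where assumption (II) makes
it the flip; it therefore transposes the coefficient matrix. -/
theorem Assumptions.tensorCoord_σ (h : Assumptions s) (he : ∀ i, e i ∈ centralSubmodule A E)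
    (x : NCTensor A E E) (j l : Fin n) :
    tensorCoord e j l (s.σ x) = tensorCoord e l j x := by
  conv_lhs => rw [← sum_tensorCoord e x]
  have hf : ∀ p q, s.σ (tmul A (e p) (e q)) = tmul A (e q) (e p) := fun p q =>
    h.flip ⟨e p, he p⟩ ⟨e q, he q⟩
  simp only [map_sum, ← op_smul_tmul, map_smul, hf]
  rw [Finset.sum_comm]
  refine Eq.trans ?_ (tensorCoord_sum e (fun q p => tensorCoord e p q x) j l)
  simp only [map_sum, ← op_smul_tmul, map_smul]

theorem Assumptions.m_eq_zero_iff (h : Assumptions s) (he : ∀ i, e i ∈ centralSubmodule A E)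
    (x : NCTensor A E E) :
    C.m x = 0 ↔ ∀ j l, tensorCoord e j l x = tensorCoord e l j x := by
  rw [← s.σ_eq_self_iff]
  refine ⟨fun hx j l => ?_, fun hx => tensor_ext e fun j l => ?_⟩
  · rw [← h.tensorCoord_σ he, hx]
  · rw [h.tensorCoord_σ he, hx]

end Torsion

/-! ### Metric compatibility as equations for the Christoffel symbols. -/

section Compatible

/-- The coordinates of a central element in a central basis are central. -/
theorem basisCoord_mem_center (he : ∀ i, e i ∈ centralSubmodule A E) (ω : ZE A E) (j : Fin n) :
    basisCoord e j (ω : E) ∈ Subalgebra.center ℂ A := by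
  rw [Subalgebra.mem_center_iff]
  intro a
  -- Here $a$ passes through the central $e_i$. Comparing coordinates with those of $\omega
  -- a=a\omega$ gives the commutation of $a$ with each coordinate.
  have h2 : a • (ω : E) = ∑ i, op (a * basisCoord e i (ω : E)) • e i := by
    conv_lhs => rw [← sum_basisCoord e (ω : E)]
    rw [Finset.smul_sum]
    refine Finset.sum_congr rfl fun i _ => ?_
    rw [smul_comm, he i a, ← mul_smul, ← op_mul]
  have h3 := congrArg (basisCoord e j) h2
  rw [central_smul, basisCoord_op_smul, map_sum] at h3
  simp only [basisCoord_op_smul, basisCoord_basis] at h3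
  simpa using h3.symm

/-- The $e_i$ span $\mathcal Z(\mathcal E)$ over $\mathcal Z(\mathcal A)$, so a $\mathcal Z(\mathcal
A)$-bilinear map such as $S^0_g(\nabla)$ is determined by its values on pairs $(e_i,e_j)$. -/
theorem central_eq_sum (he : ∀ i, e i ∈ centralSubmodule A E) (ω : ZE A E) :
    ω = ∑ i, (⟨basisCoord e i (ω : E), basisCoord_mem_center he ω i⟩ : ZA A) •
      (⟨e i, he i⟩ : ZE A E) := by
  apply Subtype.ext
  conv_lhs => rw [← sum_basisCoord e (ω : E)]
  rw [AddSubmonoidClass.coe_finsetSum]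
  exact Finset.sum_congr rfl fun i _ => (he i _).symm

/-- Since $\Pi_g=dg-S_g$, compatibility says $S_g(\nabla)=0$. This is governed by $S^0_g(\nabla)$ on
central elements, and bilinearity over $\mathcal Z(\mathcal A)$ reduces it to the basis. -/
theorem isCompatible_iff_basis (h : Assumptions s) (he : ∀ i, e i ∈ centralSubmodule A E)
    (g : Metric s) (N : C.Connection) :
    IsCompatible h g N ↔ ∀ i j, S0 h g N ⟨e i, he i⟩ ⟨e j, he j⟩ = 0 := by
  have hc : IsCompatible h g N ↔ ∀ ω η : E, Sg h g N (tmul A ω η) = 0 :=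
    forall₂_congr fun ω η => sub_eq_self
  rw [hc]
  refine ⟨fun hS i j => ?_, fun hS ω η => ?_⟩
  · have h1 := Sg_tmul h g N ⟨e i, he i⟩ ⟨e j, he j⟩ 1 1
    simpa [hS] using h1.symm
  · have h0 : S0Bilin h g N = 0 := by
      ext ω η
      rw [central_eq_sum he ω, central_eq_sum he η]
      simp only [map_sum, map_smul, LinearMap.sum_apply, LinearMap.smul_apply]
      have hb : ∀ i j, S0Bilin h g N ⟨e i, he i⟩ ⟨e j, he j⟩ = 0 := hS
      simp [hb]
    have h0' : ∀ ω η, S0 h g N ω η = 0 := fun ω η =>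
      DFunLike.congr_fun (DFunLike.congr_fun h0 ω) η
    -- By (III), $\mathcal E$ is additively generated by the $xa$ with $x$ central, and on such
    -- pairs $S_g$ is $S^0_g$ times an element of $\mathcal A$.
    refine h.central_induction (p := fun ω => Sg h g N (tmul A ω η) = 0) ω ?_ (fun x a => ?_) ?_
    · rw [zero_tmul, map_zero]
    · refine h.central_induction (p := fun η => Sg h g N (tmul A (op a • (x : E)) η) = 0) η ?_
        (fun y b => ?_) ?_
      · rw [tmul_zero, map_zero]
      · rw [Sg_tmul, h0', smul_zero]
      · intro y z hy hz; rw [tmul_add, map_add, hy, hz, add_zero]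
    · intro y z hy hz; rw [add_tmul, map_add, hy, hz, add_zero]

/-- On $e_p\otimes e_qa$ the contraction with $e_j$ is $k\,\delta_{pj}\,e_qa=\delta_{pj}\,e_q\,ka$.
Centrality of $e_q$ is what puts $k$ to the left of the coefficient. -/
theorem basisCoord_contract_conformal (h : Assumptions s)
    (he : ∀ i, e i ∈ centralSubmodule A E) {g₀ : Metric s}
    (hδ : ∀ i j, g₀.toLin (tmul A (e i) (e j)) = if i = j then 1 else 0) (k : Aˣ)
    (j l : Fin n) (x : NCTensor A E E) :
    basisCoord e l ((g₀.conformal k).tensorId (h.σ₂₃ (tensorRight A (e j) x))) =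
      k * tensorCoord e j l x := by
  have hb : ∀ p q (a : A), (g₀.conformal k).tensorId (h.σ₂₃ (tensorRight A (e j)
      (tmul A (e p) (op a • e q)))) = if p = j then op ((k : A) * a) • e q else 0 := by
    intro p q a
    refine (contract_tmul h (g₀.conformal k) ⟨e j, he j⟩ (e p) (op a • e q)).trans ?_
    show ((k : A) * g₀.toLin (tmul A (e p) (e j))) • op a • e q = _
    rw [hδ]
    split_ifs with hp
    · rw [mul_one, smul_comm, he q, ← mul_smul, ← op_mul]
    · rw [mul_zero, zero_smul]
  conv_lhs => rw [← sum_tensorCoord e x]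
  simp only [map_sum, hb]
  rw [Finset.sum_eq_single j]
  · simp [basisCoord_basis]
  · intro p _ hp; simp [hp]
  · simp

/-- Coordinate by coordinate, $S^0_g(\nabla)(e_i,e_j)=0$ reads
$\delta_{ij}\,\partial_l(k)=k(\Gamma^i_{jl}+\Gamma^j_{il})$; then $k$ is cancelled on the left. -/
theorem isCompatible_conformal_iff (h : Assumptions s)
    (he : ∀ i, e i ∈ centralSubmodule A E) {g₀ : Metric s}
    (hδ : ∀ i j, g₀.toLin (tmul A (e i) (e j)) = if i = j then 1 else 0) (k : Aˣ)
    (N : C.Connection) :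
    IsCompatible h (g₀.conformal k) N ↔ ∀ i j l,
      tensorCoord e j l (N.toLin (e i)) + tensorCoord e i l (N.toLin (e j)) =
        if i = j then ((k⁻¹ : Aˣ) : A) * C.partialD e l (k : A) else 0 := by
  rw [isCompatible_iff_basis h he]
  refine forall₂_congr fun i j => ?_
  have hS : S0 h (g₀.conformal k) N ⟨e i, he i⟩ ⟨e j, he j⟩ = 0 ↔ ∀ l,
      (if i = j then C.partialD e l (k : A) else 0) =
        k * (tensorCoord e j l (N.toLin (e i)) + tensorCoord e i l (N.toLin (e j))) := by
    rw [S0, sub_eq_zero]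
    have h1 : ∀ l, basisCoord e l (C.d ((g₀.conformal k).toLin (tmul A (e i) (e j)))) =
        if i = j then C.partialD e l (k : A) else 0 := fun l => by
      rw [Metric.conformal_apply, hδ]
      split_ifs
      · rw [mul_one]; rfl
      · simp
    have h2 : ∀ l, basisCoord e l (Pi0 h (g₀.conformal k) N ⟨e i, he i⟩ ⟨e j, he j⟩) =
        k * (tensorCoord e j l (N.toLin (e i)) + tensorCoord e i l (N.toLin (e j))) := fun l => by
      rw [Pi0, map_add, map_add, map_add, basisCoord_contract_conformal h he hδ,
        basisCoord_contract_conformal h he hδ, mul_add]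
    refine ⟨fun hx l => ?_, fun hx => basis_ext e fun l => ?_⟩
    · rw [← h1, ← h2, ← hx]
    · rw [h2, ← hx]; exact h1 l
  rw [hS]
  refine forall_congr' fun l => ?_
  rw [eq_comm, ← Units.eq_inv_mul_iff_mul_eq]
  split_ifs <;> simp

end Compatible

/-! ### The Koszul system and its unique solution. -/

/-- The Koszul formula in coordinates: a family `Γ`, symmetric in its last two indices, is
determined by its symmetrization in the first two. -/
theorem koszul_conformal_iff {V : Type*} [AddCommGroup V] [Module ℂ V] (c : Fin n → V)
    (Γ : Fin n → Fin n → Fin n → V) :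
    ((∀ i j l, Γ i j l = Γ i l j) ∧ ∀ i j l, Γ i j l + Γ j i l = if i = j then c l else 0) ↔
      ∀ i j l, Γ i j l = (1 / 2 : ℂ) •
        ((if i = l then c j else 0) + (if i = j then c l else 0) - (if j = l then c i else 0)) := by
  refine ⟨fun ⟨hs, hc⟩ i j l => ?_, fun h => ⟨fun i j l => ?_, fun i j l => ?_⟩⟩
  · rw [← hc i l j, ← hc i j l, ← hc j l i, hs i l j, hs l j i, hs j l i, hs l i j]
    module
  · rw [h, h, add_comm (if i = l then c j else 0)]
    simp only [eq_comm (a := j) (b := l)]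
  · rw [h, h]
    -- For $i=j$ the first and third terms cancel, and two halves of $c_l$ remain. For $i\ne j$ the
    -- first term of each symbol cancels the third term of the other.
    by_cases hij : i = j
    · subst hij
      simp only [if_true]
      module
    · simp only [hij, Ne.symm hij, if_false]
      module

/-- Christoffel symbols of the Levi-Civita connections of a conformal deformation of a flat
metric. -/
theorem isLeviCivita_conformal_iff (h : Assumptions s) (he : ∀ i, e i ∈ centralSubmodule A E)
    {g₀ : Metric s} (hδ : ∀ i j, g₀.toLin (tmul A (e i) (e j)) = if i = j then 1 else 0) (k : Aˣ)
    (hadd : ∀ ω η, C.d₁ (ω + η) = C.d₁ ω + C.d₁ η)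
    (hmul : ∀ ω (a : A), C.d₁ (op a • ω) = op a • C.d₁ ω + C.m (tmul A ω (C.d a)))
    (hd : ∀ i, C.d₁ (e i) = 0) (N : C.Connection) :
    IsLeviCivita h (g₀.conformal k) N ↔
      ∀ i j l, tensorCoord e j l (N.toLin (e i)) = (1 / 2 : ℂ) •
        ((if i = l then ((k⁻¹ : Aˣ) : A) * C.partialD e j (k : A) else 0) +
          (if i = j then ((k⁻¹ : Aˣ) : A) * C.partialD e l (k : A) else 0) -
          (if j = l then ((k⁻¹ : Aˣ) : A) * C.partialD e i (k : A) else 0)) := by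
  rw [IsLeviCivita, isTorsionless_iff_basis hadd hmul hd, isCompatible_conformal_iff h he hδ]
  simp only [h.m_eq_zero_iff he]
  exact koszul_conformal_iff (fun l => ((k⁻¹ : Aˣ) : A) * C.partialD e l (k : A))
    (fun i j l => tensorCoord e j l (N.toLin (e i)))

end DiffCalculus

/-! ### The differential on one-forms of a spectral triple. -/

namespace SpectralTriple

open MulOpposite NCTensor

variable {H : Type*} [NormedAddCommGroup H] [InnerProductSpace ℂ H] [CompleteSpace H]
  (S : SpectralTriple H)

/-- The quotient by junk forms makes the value independent of the representative chosen in the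
definition of `d₁`; additivity and the Leibniz rule can then be checked on any representative. -/
theorem d₁_repHom (x : S.A ⊗[ℤ] S.A) : S.d₁ (S.repHom x) = S.dRepHom x := by
  rw [d₁, ← sub_eq_zero, ← map_sub]
  apply S.dRepHom_eq_zero
  rw [map_sub, Function.surjInv_eq S.repHom_surjective, sub_self]

theorem d₁_add (ω η : S.OneForm) : S.d₁ (ω + η) = S.d₁ ω + S.d₁ η := by
  obtain ⟨x, rfl⟩ := S.repHom_surjective ω
  obtain ⟨y, rfl⟩ := S.repHom_surjective η
  rw [← map_add, d₁_repHom, d₁_repHom, d₁_repHom, map_add]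

/-- For $\omega=(db)c$ one has $\omega a=(db)(ca)$, and $db\otimes d(ca)=(db\otimes
dc)a+(db)c\otimes da$. -/
theorem d₁_op_smul (ω : S.OneForm) (a : S.A) :
    S.d₁ (op a • ω) = op a • S.d₁ ω + S.m (tmul S.A ω (S.d a)) := by
  obtain ⟨x, rfl⟩ := S.repHom_surjective ω
  induction x using TensorProduct.induction_on with
  | zero =>
    have h0 : S.d₁ 0 = 0 := by simpa using S.d₁_add 0 0
    rw [map_zero, smul_zero, h0, smul_zero, zero_tmul, map_zero, add_zero]
  | tmul b c =>
    have h1 : op a • S.repHom (b ⊗ₜ c) = S.repHom (b ⊗ₜ (c * a)) := by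
      rw [repHom_tmul, repHom_tmul, op_mul, mul_smul]
    rw [h1, d₁_repHom, d₁_repHom, dRepHom_tmul, dRepHom_tmul, repHom_tmul, d_mul, tmul_add,
      map_add, smul_tmul, ← op_smul_tmul, map_smul]
  | add x y hx hy =>
    rw [map_add, smul_add, d₁_add, d₁_add, hx, hy, add_tmul, map_add, smul_add]
    abel

end SpectralTriple

/-! ### Existence, uniqueness and the Christoffel symbols. -/

theorem mainTheorem9 {H : Type*} [NormedAddCommGroup H] [InnerProductSpace ℂ H] [CompleteSpace H]
    (S : SpectralTriple H) {n : ℕ} (e : Module.Basis (Fin n) S.Aᵐᵒᵖ S.OneForm)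
    (he : ∀ i, e i ∈ DiffCalculus.centralSubmodule S.A S.OneForm)
    (s : S.calculus.Splitting) (h : DiffCalculus.Assumptions s)
    (hd : ∀ i, S.calculus.d₁ (e i) = 0)
    (g₀ : DiffCalculus.Metric s) (hg₀ : g₀.IsBimetric)
    (hδ : ∀ i j, g₀.toLin (NCTensor.tmul S.A (e i) (e j)) = if i = j then 1 else 0)
    (h₀ : ∀ N₀ : S.calculus.Connection, DiffCalculus.IsLeviCivita h g₀ N₀ →
      ∀ i, N₀.toLin (e i) = 0)
    (k : S.Aˣ) :
    (∃! N : S.calculus.Connection, DiffCalculus.IsLeviCivita h (g₀.conformal k) N) ∧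
    ∀ N : S.calculus.Connection, DiffCalculus.IsLeviCivita h (g₀.conformal k) N →
      ∀ Γ : Fin n → Fin n → Fin n → S.A,
        DiffCalculus.IsChristoffel e N Γ ↔
          ∀ i j l, Γ i j l = (1 / 2 : ℂ) •
            ((if i = l then ((k⁻¹ : S.Aˣ) : S.A) * S.calculus.partialD e j (k : S.A) else 0) +
             (if i = j then ((k⁻¹ : S.Aˣ) : S.A) * S.calculus.partialD e l (k : S.A) else 0) -
             (if j = l then ((k⁻¹ : S.Aˣ) : S.A) * S.calculus.partialD e i (k : S.A) else 0)) := by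
  -- One-forms are bounded operators and $\mathcal A$ is unital, so a scalar acts as a multiple of
  -- the identity from either side. This makes the Leibniz extension from the basis $\mathbb
  -- C$-linear.
  have hl : ∀ (c : ℂ) (ω : S.OneForm), c • ω = algebraMap ℂ S.A c • ω := fun c ω =>
    Subtype.ext (Algebra.smul_def c (ω : H →L[ℂ] H))
  have hr : ∀ (c : ℂ) (ω : S.OneForm), c • ω = MulOpposite.op (algebraMap ℂ S.A c) • ω :=
    fun c ω => Subtype.ext ((Algebra.smul_def c (ω : H →L[ℂ] H)).trans (Algebra.commutes _ _))
  have key := DiffCalculus.isLeviCivita_conformal_iff h he hδ k S.d₁_add S.d₁_op_smul hd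
  refine ⟨?_, fun N hN Γ => ?_⟩
  -- The witness is the Leibniz extension of the claimed Christoffel symbols. Uniqueness follows
  -- because `key` fixes every coordinate of $\nabla(e_i)$.
  · refine ⟨DiffCalculus.Connection.ofBasis S.calculus e hl hr fun i =>
      ∑ j, ∑ l, NCTensor.tmul S.A (e j) (MulOpposite.op ((1 / 2 : ℂ) •
        ((if i = l then ((k⁻¹ : S.Aˣ) : S.A) * S.calculus.partialD e j (k : S.A) else 0) +
          (if i = j then ((k⁻¹ : S.Aˣ) : S.A) * S.calculus.partialD e l (k : S.A) else 0) -
          (if j = l then ((k⁻¹ : S.Aˣ) : S.A) * S.calculus.partialD e i (k : S.A) else 0))) • e l),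
      (key _).2 fun i j l => ?_, fun N hN => ?_⟩
    · rw [DiffCalculus.Connection.ofBasis_basis, DiffCalculus.tensorCoord_sum]
    · refine DiffCalculus.Connection.ext_basis (e := e) fun i => ?_
      rw [DiffCalculus.Connection.ofBasis_basis, ← DiffCalculus.sum_tensorCoord e (N.toLin (e i))]
      simp only [(key N).1 hN]
  · rw [DiffCalculus.isChristoffel_iff]
    simp only [(key N).1 hN]
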